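/- Let $\mathbb H=\mathbb T\times\mathbb R\times\mathbb R$ be the (reduced) Heisenberg group, with the usual topology and smooth structure, the group law $$(z_1,y_1,x_1)(z_2,y_2,x_2)=\bigl(z_1z_2e^{-2\pi i x_1y_2},\;y_1+y_2,\;x_1+x_2\bigr),$$ center $Z=\{(z,0,0):z\in\mathbb T\}$, and Lebesgue measure, which is left-invariant. For $k\in\mathbb H$ let $L_k$ be the left translation operator $L_kF(h)=F(k^{-1}h)$ on $L^2(\mathbb H)$. **Corollary 3.4.** Let $F:\mathbb H\to\mathbb C$ be a smooth, compactly supported function that is not identically zero. Then the Heisenberg-Translate conjecture holds for $F$: for every finite subset $\mathcal F\subset\mathbb H$ such that the cosets $hZ$, $h\in\mathcal F$, are distinct, the family of vectors $(L_hF)_{h\in\mathcal F}$ is linearly independent over $\mathbb C$ in $L^2(\mathbb H)$. -/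

import Mathlib

open MeasureTheory
open scoped Manifold ContDiff ENNReal

noncomputable section

instance Circle.instMeasurableSpaceBorel : MeasurableSpace Circle := borel Circle

instance Circle.instBorelSpaceBorel : BorelSpace Circle := ⟨rfl⟩

/-- The (reduced) Heisenberg group, as a set `𝕋 × ℝ × ℝ`; its points are written `(z, y, x)`.
It carries the usual topology and smooth structure of `𝕋 × ℝ × ℝ`, but not the product
group structure. -/
def Heisenberg : Type := Circle × ℝ × ℝ

namespace Heisenberg

/-- The point `(z, y, x)`. -/
def mk (z : Circle) (y x : ℝ) : Heisenberg := (z, y, x)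

/-- The central coordinate. -/
def z (h : Heisenberg) : Circle := h.1

/-- The modulation coordinate. -/
def y (h : Heisenberg) : ℝ := h.2.1

/-- The translation coordinate. -/
def x (h : Heisenberg) : ℝ := h.2.2

@[simp] theorem mk_z (z : Circle) (y x : ℝ) : (mk z y x).z = z := rfl
@[simp] theorem mk_y (z : Circle) (y x : ℝ) : (mk z y x).y = y := rfl
@[simp] theorem mk_x (z : Circle) (y x : ℝ) : (mk z y x).x = x := rfl

@[ext] theorem ext {g h : Heisenberg} (hz : g.z = h.z) (hy : g.y = h.y) (hx : g.x = h.x) :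
    g = h :=
  Prod.ext hz (Prod.ext hy hx)

instance : TopologicalSpace Heisenberg := inferInstanceAs (TopologicalSpace (Circle × ℝ × ℝ))
instance : T2Space Heisenberg := inferInstanceAs (T2Space (Circle × ℝ × ℝ))
instance : MeasurableSpace Heisenberg := inferInstanceAs (MeasurableSpace (Circle × ℝ × ℝ))
instance : BorelSpace Heisenberg := inferInstanceAs (BorelSpace (Circle × ℝ × ℝ))
instance : ChartedSpace (ModelProd (EuclideanSpace ℝ (Fin 1)) (ℝ × ℝ)) Heisenberg :=
  inferInstanceAs
    (ChartedSpace (ModelProd (EuclideanSpace ℝ (Fin 1)) (ℝ × ℝ)) (Circle × (ℝ × ℝ)))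
instance : IsManifold ((𝓡 1).prod 𝓘(ℝ, ℝ × ℝ)) ∞ Heisenberg :=
  inferInstanceAs (IsManifold ((𝓡 1).prod 𝓘(ℝ, ℝ × ℝ)) ∞ (Circle × (ℝ × ℝ)))

/-- `(z₁, y₁, x₁) (z₂, y₂, x₂) = (z₁ z₂ e^{-2πi x₁ y₂}, y₁ + y₂, x₁ + x₂)`. -/
instance : Mul Heisenberg :=
  ⟨fun g h => mk (g.z * h.z * Circle.exp (-(2 * Real.pi * (g.x * h.y)))) (g.y + h.y) (g.x + h.x)⟩

instance : One Heisenberg := ⟨mk 1 0 0⟩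

instance : Inv Heisenberg :=
  ⟨fun g => mk (g.z⁻¹ * Circle.exp (-(2 * Real.pi * (g.x * g.y)))) (-g.y) (-g.x)⟩

theorem mul_def (g h : Heisenberg) : g * h =
    mk (g.z * h.z * Circle.exp (-(2 * Real.pi * (g.x * h.y)))) (g.y + h.y) (g.x + h.x) := rfl

theorem one_def : (1 : Heisenberg) = mk 1 0 0 := rfl

theorem inv_def (g : Heisenberg) :
    g⁻¹ = mk (g.z⁻¹ * Circle.exp (-(2 * Real.pi * (g.x * g.y)))) (-g.y) (-g.x) := rfl

instance : Group Heisenberg :=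
  Group.ofLeftAxioms
    (by
      intro a b c
      apply Heisenberg.ext
      · have h1 : Circle.exp (-(2 * Real.pi * ((a.x + b.x) * c.y))) =
            Circle.exp (-(2 * Real.pi * (a.x * c.y))) *
              Circle.exp (-(2 * Real.pi * (b.x * c.y))) := by
          rw [← Circle.exp_add]; congr 1; ring
        have h2 : Circle.exp (-(2 * Real.pi * (a.x * (b.y + c.y)))) =
            Circle.exp (-(2 * Real.pi * (a.x * b.y))) *
              Circle.exp (-(2 * Real.pi * (a.x * c.y))) := by
          rw [← Circle.exp_add]; congr 1; ring
        simp only [mul_def, mk_z, mk_y, mk_x, h1, h2]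
        ac_rfl
      · simp [mul_def, add_assoc]
      · simp [mul_def, add_assoc])
    (by intro a; apply Heisenberg.ext <;> simp [mul_def, one_def])
    (by
      intro a
      apply Heisenberg.ext
      · simp only [mul_def, inv_def, one_def, mk_z, mk_y, mk_x]
        rw [mul_right_comm a.z⁻¹, inv_mul_cancel, one_mul, ← Circle.exp_add]
        rw [show -(2 * Real.pi * (a.x * a.y)) + -(2 * Real.pi * (-a.x * a.y)) = 0 by ring,
          Circle.exp_zero]
      · simp [mul_def, inv_def, one_def]
      · simp [mul_def, inv_def, one_def])

/-- The center `Z = {(z, 0, 0) : z ∈ 𝕋}`. -/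
def Z : Subgroup Heisenberg where
  carrier := {h | ∃ w : Circle, h = mk w 0 0}
  mul_mem' := by
    rintro _ _ ⟨u, rfl⟩ ⟨v, rfl⟩
    exact ⟨u * v, by apply Heisenberg.ext <;> simp [mul_def]⟩
  one_mem' := ⟨1, rfl⟩
  inv_mem' := by
    rintro _ ⟨u, rfl⟩
    exact ⟨u⁻¹, by apply Heisenberg.ext <;> simp [inv_def]⟩

/-- Lebesgue measure on `𝕋 × ℝ × ℝ`, the circle having total mass one. -/
def lebesgue : Measure Heisenberg :=
  (Measure.haarMeasure (⊤ : TopologicalSpace.PositiveCompacts Circle)).prod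
    (volume : Measure (ℝ × ℝ))

/-- Lebesgue measure is invariant under left multiplication. -/
theorem measurePreserving_mul_left (k : Heisenberg) :
    MeasurePreserving (fun h : Heisenberg => k * h) lebesgue lebesgue := by
  have base : MeasurePreserving (fun p : ℝ × ℝ => (k.y, k.x) + p) volume volume :=
    measurePreserving_add_left volume _
  have skew : MeasurePreserving
      (fun q : (ℝ × ℝ) × Circle =>
        ((k.y, k.x) + q.1, k.z * q.2 * Circle.exp (-(2 * Real.pi * (k.x * q.1.1)))))
      ((volume : Measure (ℝ × ℝ)).prod (Measure.haarMeasure ⊤))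
      ((volume : Measure (ℝ × ℝ)).prod (Measure.haarMeasure ⊤)) := by
    refine MeasurePreserving.skew_product
      (g := fun (p : ℝ × ℝ) (w : Circle) =>
        k.z * w * Circle.exp (-(2 * Real.pi * (k.x * p.1)))) base ?_ ?_
    · apply Continuous.measurable
      simp only [Function.uncurry_def]
      fun_prop
    · refine Filter.Eventually.of_forall fun p => ?_
      have : (fun w : Circle => k.z * w * Circle.exp (-(2 * Real.pi * (k.x * p.1)))) =
          fun w => (k.z * Circle.exp (-(2 * Real.pi * (k.x * p.1)))) * w := by
        funext w; rw [mul_right_comm]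
      rw [this]
      exact map_mul_left_eq_self _ _
  exact (Measure.measurePreserving_swap.comp skew).comp Measure.measurePreserving_swap

/-- The Hilbert space `L²(ℍ)`. -/
abbrev L2 : Type := Lp ℂ 2 lebesgue

/-- Left translation `L_k F (h) = F (k⁻¹ h)`, as a linear isometry of `L²(ℍ)`. -/
def leftTranslate (k : Heisenberg) : L2 →ₗᵢ[ℂ] L2 :=
  Lp.compMeasurePreservingₗᵢ ℂ (fun h : Heisenberg => k⁻¹ * h) (measurePreserving_mul_left k⁻¹)

/-- The Heisenberg-Translate conjecture holds for `F`: whenever `S` is a finite set of points of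
the group lying in pairwise distinct cosets of `Z`, the family `L_h F`, `h ∈ S`, is linearly
independent in `L²(ℍ)`. -/
def HeisenbergTranslateHoldsFor (F : L2) : Prop :=
  ∀ S : Finset Heisenberg,
    Set.InjOn (fun h : Heisenberg => (h : Heisenberg ⧸ Z)) (S : Set Heisenberg) →
    LinearIndependent ℂ (fun h : S => leftTranslate h F)

/-- The space `C_c^∞(ℍ)` of smooth compactly supported complex-valued functions. -/
structure IsSmoothCompactlySupported (f : Heisenberg → ℂ) : Prop where
  smooth : ContMDiff ((𝓡 1).prod 𝓘(ℝ, ℝ × ℝ)) 𝓘(ℝ, ℂ) ∞ f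
  compactSupport : HasCompactSupport f

/-- Smooth compactly supported functions are square integrable. -/
theorem IsSmoothCompactlySupported.memLp {f : Heisenberg → ℂ}
    (hf : IsSmoothCompactlySupported f) : MemLp f 2 lebesgue := by
  have : IsFiniteMeasureOnCompacts lebesgue :=
    inferInstanceAs (IsFiniteMeasureOnCompacts
      ((Measure.haarMeasure (⊤ : TopologicalSpace.PositiveCompacts Circle)).prod
        (volume : Measure (ℝ × ℝ))))
  exact hf.smooth.continuous.memLp_of_hasCompactSupport hf.compactSupport

end Heisenberg

end

namespace Heisenberg

/-! The maps `slope t` are continuous homomorphisms to `ℝ` that kill the center, and all but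
finitely many `t` separate a given finite set of cosets. Translating by `k` shifts the slopes on the
support by `slope t k`. So, among the translates with nonzero coefficient, the one of largest slope
reaches slopes that no other attains, and it cannot be cancelled
(`coeff_eq_zero_of_sum_translate_eq_zero`). -/

theorem continuous_mul_left (k : Heisenberg) : Continuous (fun h : Heisenberg => k * h) := by
  have : Continuous (fun p : Circle × ℝ × ℝ =>
      ((k.z * p.1 * Circle.exp (-(2 * Real.pi * (k.x * p.2.1))), k.y + p.2.1, k.x + p.2.2) :
        Circle × ℝ × ℝ)) := by
    fun_prop
  exact this

instance : lebesgue.IsOpenPosMeasure :=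
  inferInstanceAs (Measure.IsOpenPosMeasure
    ((Measure.haarMeasure (⊤ : TopologicalSpace.PositiveCompacts Circle)).prod
      (volume : Measure (ℝ × ℝ))))

/-- The homomorphism `(z, y, x) ↦ y + t x` from the Heisenberg group to `ℝ`. -/
def slope (t : ℝ) (h : Heisenberg) : ℝ := h.y + t * h.x

/-- The noncommutative twist affects only the central coordinate, which `slope` ignores. -/
theorem slope_mul (t : ℝ) (g h : Heisenberg) : slope t (g * h) = slope t g + slope t h := by
  simp only [slope, mul_def, mk_y, mk_x]; ring

theorem slope_inv (t : ℝ) (g : Heisenberg) : slope t g⁻¹ = -slope t g := by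
  simp only [slope, inv_def, mk_y, mk_x]; ring

theorem continuous_slope (t : ℝ) : Continuous (slope t) := by
  have : Continuous (fun p : Circle × ℝ × ℝ => p.2.1 + t * p.2.2) := by fun_prop
  exact this

theorem coset_eq_of_y_eq_of_x_eq {g h : Heisenberg} (hy : g.y = h.y) (hx : g.x = h.x) :
    (g : Heisenberg ⧸ Z) = h := by
  rw [QuotientGroup.eq]
  exact ⟨(g⁻¹ * h).z, by apply Heisenberg.ext <;> simp [mul_def, inv_def, hy, hx]⟩

/-- Finitely many points in distinct cosets of the center are separated by some `slope t`. -/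
theorem exists_slope_injOn (S : Finset Heisenberg)
    (hS : Set.InjOn (fun h : Heisenberg => (h : Heisenberg ⧸ Z)) (S : Set Heisenberg)) :
    ∃ t : ℝ, Set.InjOn (slope t) (S : Set Heisenberg) := by
  classical
  -- Two points with different `x` have equal slope for exactly one `t`. Pairs with equal `x`
  -- contribute the junk value `0`, harmlessly excluded.
  obtain ⟨t, ht⟩ := Infinite.exists_notMem_finset
    ((S ×ˢ S).image fun p => (p.2.y - p.1.y) / (p.1.x - p.2.x))
  refine ⟨t, fun g hg h hh hgh => hS hg hh ?_⟩
  simp only [slope] at hgh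
  by_cases hx : g.x = h.x
  · exact coset_eq_of_y_eq_of_x_eq (by rw [hx] at hgh; linarith) hx
  · refine absurd (Finset.mem_image.2 ⟨(g, h), Finset.mk_mem_product hg hh, ?_⟩) ht
    rw [div_eq_iff (sub_ne_zero.2 hx)]
    linarith

/-- Left translates of a nonzero compactly supported function by finitely many elements which
are separated by `slope t` are linearly independent as functions. -/
theorem coeff_eq_zero_of_sum_translate_eq_zero {f : Heisenberg → ℂ} (hc : HasCompactSupport f)
    (hne : f ≠ 0) {t : ℝ} {ι : Type*} {s : Finset ι} {k : ι → Heisenberg}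
    (hk : Set.InjOn (fun i => slope t (k i)) s) {c : ι → ℂ}
    (hsum : ∀ g, ∑ i ∈ s, c i * f ((k i)⁻¹ * g) = 0) : ∀ i ∈ s, c i = 0 := by
  classical
  by_contra! hcon
  obtain ⟨j, hj, hcj⟩ := hcon
  obtain ⟨m, hm, hmax⟩ := (s.filter fun i => c i ≠ 0).exists_max_image
    (fun i => slope t (k i)) ⟨j, Finset.mem_filter.2 ⟨hj, hcj⟩⟩
  rw [Finset.mem_filter] at hm
  have hlt : ∀ i ∈ s.filter (fun i => c i ≠ 0 ∧ i ≠ m), slope t (k i) < slope t (k m) := by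
    intro i hi
    rw [Finset.mem_filter] at hi
    exact lt_of_le_of_ne (hmax i (Finset.mem_filter.2 ⟨hi.1, hi.2.1⟩))
      fun h => hi.2.2 (hk hi.1 hm.1 h)
  have hsupp : (tsupport f).Nonempty :=
    (Function.support_nonempty_iff.2 hne).mono (subset_tsupport f)
  obtain ⟨q, hq, hqmax⟩ := hc.isCompact.exists_isMaxOn hsupp (continuous_slope t).continuousOn
  -- `f` may vanish at the extremal point `q`, so the strict inequalities are spread to a
  -- neighbourhood, where some `p` has `f p ≠ 0`.
  have hopen : ∀ᶠ p in nhds q, ∀ i ∈ s.filter (fun i => c i ≠ 0 ∧ i ≠ m),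
      slope t q < -slope t (k i) + (slope t (k m) + slope t p) := by
    rw [Filter.eventually_all_finset]
    intro i hi
    refine continuousAt_const.eventually_lt
      (((continuous_slope t).const_add _).const_add _).continuousAt ?_
    have := hlt i hi
    linarith
  obtain ⟨p, hp, hfp⟩ := (mem_closure_iff_frequently.1 hq).and_eventually hopen |>.exists
  -- Here the term `m` is `c m * f p`; every other argument has slope above the maximum over
  -- `tsupport f`.
  have key := hsum (k m * p)
  rw [Finset.sum_eq_single_of_mem m hm.1, inv_mul_cancel_left] at key
  · exact (mul_ne_zero hm.2 hp) key
  · intro i hi him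
    by_cases hci : c i = 0
    · rw [hci, zero_mul]
    have h1 := hfp i (Finset.mem_filter.2 ⟨hi, hci, him⟩)
    rw [image_eq_zero_of_notMem_tsupport (f := f), mul_zero]
    intro hmem
    have h2 : slope t ((k i)⁻¹ * (k m * p)) ≤ slope t q := hqmax hmem
    rw [slope_mul, slope_mul, slope_inv] at h2
    exact absurd h1 h2.not_gt

theorem coeFn_leftTranslate_toLp {f : Heisenberg → ℂ} (hf : MemLp f 2 lebesgue) (k : Heisenberg) :
    leftTranslate k (hf.toLp f) =ᵐ[lebesgue] fun g => f (k⁻¹ * g) :=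
  (Lp.coeFn_compMeasurePreserving _ (measurePreserving_mul_left k⁻¹)).trans
    ((measurePreserving_mul_left k⁻¹).quasiMeasurePreserving.ae_eq_comp hf.coeFn_toLp)

theorem sum_smul_leftTranslate_toLp_ae_eq {f : Heisenberg → ℂ} (hf : MemLp f 2 lebesgue)
    {ι : Type*} (s : Finset ι) (k : ι → Heisenberg) (c : ι → ℂ) :
    (∑ i ∈ s, c i • leftTranslate (k i) (hf.toLp f) : L2) =ᵐ[lebesgue]
      fun g => ∑ i ∈ s, c i * f ((k i)⁻¹ * g) := by
  have h : ∀ᵐ g ∂lebesgue, ∀ i ∈ s,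
      (c i • leftTranslate (k i) (hf.toLp f) : L2) g = c i * f ((k i)⁻¹ * g) := by
    rw [Filter.eventually_all_finset]
    intro i _
    filter_upwards [Lp.coeFn_smul (c i) (leftTranslate (k i) (hf.toLp f)),
      coeFn_leftTranslate_toLp hf (k i)] with g h1 h2
    rw [h1, Pi.smul_apply, h2, smul_eq_mul]
  filter_upwards [h, Lp.coeFn_finsetSum s fun i => c i • leftTranslate (k i) (hf.toLp f)]
    with g h1 h2
  rw [h2, Finset.sum_apply]
  exact Finset.sum_congr rfl h1

end Heisenberg

/-- The Heisenberg-Translate conjecture holds for every nonzero function in `C_c^∞(ℍ)`. -/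
theorem corollary3p4 (f : Heisenberg → ℂ) (hf : Heisenberg.IsSmoothCompactlySupported f)
    (hne : f ≠ 0) : Heisenberg.HeisenbergTranslateHoldsFor (hf.memLp.toLp f) := by
  intro S hS
  obtain ⟨t, ht⟩ := Heisenberg.exists_slope_injOn S hS
  rw [linearIndependent_iff']
  intro s c hzero
  refine Heisenberg.coeff_eq_zero_of_sum_translate_eq_zero (t := t) (k := fun i : S => i.1)
    hf.compactSupport hne (fun i _ j _ hij => Subtype.ext (ht i.2 j.2 hij)) ?_
  have hae := Heisenberg.sum_smul_leftTranslate_toLp_ae_eq hf.memLp s (fun i : S => i.1) c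
  rw [hzero] at hae
  have hcont : Continuous fun g => ∑ i ∈ s, c i * f ((i.1)⁻¹ * g) :=
    continuous_finsetSum _ fun i _ => continuous_const.mul
      (hf.smooth.continuous.comp (Heisenberg.continuous_mul_left _))
  -- Nonempty open sets have positive measure, so a continuous function vanishing a.e. vanishes
  -- everywhere.
  have heq := (hcont.ae_eq_iff_eq Heisenberg.lebesgue continuous_zero).1
    (hae.symm.trans (Lp.coeFn_zero ℂ 2 Heisenberg.lebesgue))
  exact fun g => congrFun heq g
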